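/- Let $X$ and $U$ be (real or complex) Hilbert spaces. For $j=1,2$ let $A_j:D(A_j)\subset X\to X$ be the generator of a $C_0$-semigroup $e^{A_jt}$ on $X$. Let $[D(A_j^*)]'$ be the dual of $D(A_j^*)$ (with its graph norm) with respect to the pivot space $X$, so that $X\subset[D(A_j^*)]'$ through $\langle x,y\rangle_{[D(A_j^*)]',D(A_j^*)}=\langle x,y\rangle_X$, let $e^{\tilde A_jt}$ be the extension of $e^{A_jt}$ to $[D(A_j^*)]'$, that is, $\langle e^{\tilde A_jt}z,y\rangle=\langle z,e^{A_j^*t}y\rangle$ for $z\in[D(A_j^*)]'$, $y\in D(A_j^*)$, and let $B_j\in\mathcal L(U,[D(A_j^*)]')$. For $t>0$ define $$\Phi_j(t)f=\int_0^te^{\tilde A_j(t-s)}B_jf(s)\,ds\in[D(A_j^*)]',\qquad f\in L^2_{\rm loc}([0,\infty);U).$$ The operator $B_j$ is called admissible for $e^{A_jt}$ if ${\rm Ran}\,\Phi_j(\tau)\subset X$ for some $\tau>0$. The pair $(A_j,B_j)$ is called exactly (respectively approximately) controllable in time $\tau>0$ if $B_j$ is admissible for $e^{A_jt}$ and ${\rm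 Ran}\,\Phi_j(\tau)=X$ (respectively ${\rm Ran}\,\Phi_j(\tau)$ is dense in $X$), and exactly (respectively approximately) controllable if it is so in some time $\tau>0$. Suppose that $P\in\mathcal L(X)$ is boundedly invertible, that $D(A_2)=PD(A_1)$ and $PA_1P^{-1}=A_2$ (in short, $A_1\sim_PA_2$; then $P^*D(A_2^*)=D(A_1^*)$), and that $$\langle B_2u,x\rangle_{[D(A_2^*)]',D(A_2^*)}=\langle B_1u,P^*x\rangle_{[D(A_1^*)]',D(A_1^*)}\qquad\text{for all }u\in U,\ x\in D(A_2^*).$$ Then: (i) $B_1$ is admissible for $e^{A_1t}$ if and only if $B_2$ is admissible for $e^{A_2t}$; (ii) for every $\tau>0$, $(A_1,B_1)$ is exactly (respectively approximately) controllable in time $\tau$ if and only if $(A_2,B_2)$ is exactly (respectively approximately) controllable in time $\tau$; in particular, $(A_1,B_1)$ is exactly (respectively approximately) controllable if and only if $(A_2,B_2)$ is exactly (respectively approximately) controllable. -/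

import Mathlib

open Filter Topology MeasureTheory
open scoped NNReal InnerProductSpace LinearPMap

noncomputable section

variable {𝕜 X U : Type*} [RCLike 𝕜]
variable [NormedAddCommGroup X] [InnerProductSpace 𝕜 X]
variable [NormedAddCommGroup U] [InnerProductSpace 𝕜 U]

/-! ### Strongly continuous semigroups and their generators -/

/-- A `C₀`-semigroup of bounded operators on `X`. -/
structure C0Semigroup (𝕜 X : Type*) [RCLike 𝕜] [NormedAddCommGroup X]
    [InnerProductSpace 𝕜 X] where
  /-- The operator at time `t ≥ 0`. -/
  op : ℝ≥0 → X →L[𝕜] X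
  op_zero : op 0 = ContinuousLinearMap.id 𝕜 X
  op_add : ∀ s t, op (s + t) = (op s).comp (op t)
  tendsto_zero : ∀ x, Tendsto (fun t => op t x) (𝓝 0) (𝓝 x)

namespace C0Semigroup

/-- `y = lim_{h ↓ 0} h⁻¹ (T(h) x - x)`. -/
def HasGen (T : C0Semigroup 𝕜 X) (x y : X) : Prop :=
  Tendsto (fun h : ℝ≥0 => (((h : ℝ)⁻¹ : ℝ) : 𝕜) • (T.op h x - x)) (𝓝[>] 0) (𝓝 y)

theorem hasGen_zero (T : C0Semigroup 𝕜 X) : T.HasGen 0 0 := by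
  simp [HasGen]

theorem HasGen.add {T : C0Semigroup 𝕜 X} {x y x' y' : X} (h : T.HasGen x y)
    (h' : T.HasGen x' y') : T.HasGen (x + x') (y + y') := by
  refine (Tendsto.add h h').congr fun t => ?_
  rw [← smul_add, map_add]
  congr 1
  abel

theorem HasGen.smul {T : C0Semigroup 𝕜 X} {x y : X} (c : 𝕜) (h : T.HasGen x y) :
    T.HasGen (c • x) (c • y) := by
  refine (Tendsto.const_smul h c).congr fun t => ?_
  rw [map_smul, ← smul_sub, smul_comm]

theorem HasGen.unique {T : C0Semigroup 𝕜 X} {x y y' : X} (h : T.HasGen x y)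
    (h' : T.HasGen x y') : y = y' :=
  tendsto_nhds_unique h h'

/-- The semigroup maps the domain of its generator into itself and commutes with it. -/
theorem HasGen.op {T : C0Semigroup 𝕜 X} {x y : X} (h : T.HasGen x y) (t : ℝ≥0) :
    T.HasGen (T.op t x) (T.op t y) := by
  refine (((T.op t).continuous.tendsto y).comp h).congr fun s => ?_
  have hc : T.op s (T.op t x) = T.op t (T.op s x) := by
    rw [← ContinuousLinearMap.comp_apply, ← ContinuousLinearMap.comp_apply, ← T.op_add,
      ← T.op_add, add_comm]
  simp [hc]

/-- The domain of the generator. -/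
def genDomain (T : C0Semigroup 𝕜 X) : Submodule 𝕜 X where
  carrier := {x | ∃ y, T.HasGen x y}
  zero_mem' := ⟨0, T.hasGen_zero⟩
  add_mem' := fun ⟨_, h₁⟩ ⟨_, h₂⟩ => ⟨_, h₁.add h₂⟩
  smul_mem' := fun c _ ⟨_, h⟩ => ⟨_, h.smul c⟩

/-- The infinitesimal generator `A` of the semigroup, an unbounded operator on `X`. -/
def generator (T : C0Semigroup 𝕜 X) : X →ₗ.[𝕜] X where
  domain := T.genDomain
  toFun :=
    { toFun := fun x => Classical.choose x.2
      map_add' := fun x y => (Classical.choose_spec (x + y).2).unique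
        ((Classical.choose_spec x.2).add (Classical.choose_spec y.2))
      map_smul' := fun c x => (Classical.choose_spec (c • x).2).unique
        ((Classical.choose_spec x.2).smul c) }

theorem generator_spec (T : C0Semigroup 𝕜 X) (x : T.generator.domain) :
    T.HasGen x (T.generator x) :=
  Classical.choose_spec x.2

theorem op_mem_domain (T : C0Semigroup 𝕜 X) (t : ℝ≥0) (x : T.generator.domain) :
    T.op t x ∈ T.generator.domain :=
  ⟨_, (T.generator_spec x).op t⟩

theorem generator_op (T : C0Semigroup 𝕜 X) (t : ℝ≥0) (x : T.generator.domain) :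
    T.generator ⟨T.op t x, T.op_mem_domain t x⟩ = T.op t (T.generator x) :=
  (T.generator_spec _).unique ((T.generator_spec x).op t)

end C0Semigroup

variable [CompleteSpace X]

/-! ### The space `[D(A*)]'` -/

/-- The space `D(A*)`, to be normed by the graph norm of `A*`. -/
def DomAdj (A : X →ₗ.[𝕜] X) : Type _ := A†.domain

namespace DomAdj

instance (A : X →ₗ.[𝕜] X) : AddCommGroup (DomAdj A) :=
  inferInstanceAs (AddCommGroup A†.domain)

instance (A : X →ₗ.[𝕜] X) : Module 𝕜 (DomAdj A) :=
  inferInstanceAs (Module 𝕜 A†.domain)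

/-- The inclusion `D(A*) → X`. -/
def val (A : X →ₗ.[𝕜] X) : DomAdj A →ₗ[𝕜] X := A†.domain.subtype

/-- The operator `A*` on `D(A*)`. -/
def adj (A : X →ₗ.[𝕜] X) : DomAdj A →ₗ[𝕜] X := A†.toFun

theorem val_injective (A : X →ₗ.[𝕜] X) : Function.Injective (val A) :=
  Subtype.val_injective

/-- `D(A*)` carries the graph norm `max ‖y‖ ‖A* y‖`. -/
instance (A : X →ₗ.[𝕜] X) : NormedAddCommGroup (DomAdj A) :=
  NormedAddCommGroup.induced (DomAdj A) (X × X) ((val A).prod (adj A))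
    fun _ _ h => val_injective A (congrArg Prod.fst h)

instance (A : X →ₗ.[𝕜] X) : NormedSpace 𝕜 (DomAdj A) :=
  NormedSpace.induced 𝕜 (DomAdj A) (X × X) ((val A).prod (adj A))

theorem norm_eq (A : X →ₗ.[𝕜] X) (y : DomAdj A) : ‖y‖ = max ‖val A y‖ ‖adj A y‖ :=
  rfl

end DomAdj

/-- The space `[D(A*)]'`: the dual of `D(A*)` with respect to the pivot space `X`, that is, the
bounded conjugate-linear functionals on `D(A*)`. The duality pairing `⟨z, y⟩` between `[D(A*)]'`
and `D(A*)`, linear in `z` and conjugate-linear in `y`, is `z y`. -/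
abbrev DualDomAdj (A : X →ₗ.[𝕜] X) : Type _ := DomAdj A →L⋆[𝕜] 𝕜

/-- The inclusion `X → [D(A*)]'`: the functional `y ↦ ⟨x, y⟩` (the inner product of Mathlib is
conjugate-linear in its first argument). -/
def pivotEmbedding (A : X →ₗ.[𝕜] X) (x : X) : DualDomAdj A :=
  LinearMap.mkContinuous
    { toFun := fun y => inner 𝕜 (DomAdj.val A y) x
      map_add' := fun y z => by rw [map_add, inner_add_left]
      map_smul' := fun c y => by rw [map_smul, inner_smul_left]; rfl } ‖x‖ (fun y => by
        refine (norm_inner_le_norm (𝕜 := 𝕜) (DomAdj.val A y) x).trans ?_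
        rw [mul_comm]
        exact mul_le_mul_of_nonneg_left (le_max_left _ _) (norm_nonneg x))

namespace C0Semigroup

theorem adjoint_op_mem (T : C0Semigroup 𝕜 X) (t : ℝ≥0) (y : T.generator†.domain) :
    ContinuousLinearMap.adjoint (T.op t) (y : X) ∈ T.generator†.domain := by
  have hy := (LinearPMap.mem_adjoint_domain_iff (T := T.generator) (y : X)).1 y.2
  rw [LinearPMap.mem_adjoint_domain_iff]
  have hc : Continuous fun x : T.generator.domain =>
      (⟨T.op t x, T.op_mem_domain t x⟩ : T.generator.domain) :=
    ((T.op t).continuous.comp continuous_subtype_val).subtype_mk _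
  refine (hy.comp hc).congr fun x => ?_
  change inner 𝕜 (y : X) (T.generator ⟨T.op t x, T.op_mem_domain t x⟩) =
    inner 𝕜 (ContinuousLinearMap.adjoint (T.op t) (y : X)) (T.generator x)
  rw [generator_op, ContinuousLinearMap.adjoint_inner_left]

theorem adjoint_op_comm (T : C0Semigroup 𝕜 X) (t : ℝ≥0) (y : T.generator†.domain) :
    T.generator† ⟨_, T.adjoint_op_mem t y⟩ =
      ContinuousLinearMap.adjoint (T.op t) (T.generator† y) := by
  by_cases hd : Dense (T.generator.domain : Set X)
  · refine LinearPMap.adjoint_apply_eq hd _ fun x => ?_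
    have h := LinearPMap.adjoint_isFormalAdjoint (T := T.generator) hd y
      ⟨T.op t x, T.op_mem_domain t x⟩
    rw [generator_op] at h
    change inner 𝕜 _ _ = inner 𝕜 (ContinuousLinearMap.adjoint (T.op t) (y : X)) (T.generator x)
    rw [ContinuousLinearMap.adjoint_inner_left, ContinuousLinearMap.adjoint_inner_left]
    exact h
  · rw [LinearPMap.adjoint_apply_of_not_dense hd, LinearPMap.adjoint_apply_of_not_dense hd,
      map_zero]

/-- The restriction of the adjoint semigroup operator `T(t)* = e^{A* t}` to `D(A*)`. -/
def adjointOnDom (T : C0Semigroup 𝕜 X) (t : ℝ≥0) :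
    DomAdj T.generator →L[𝕜] DomAdj T.generator :=
  LinearMap.mkContinuous
    { toFun := fun y => (⟨_, T.adjoint_op_mem t y⟩ : T.generator†.domain)
      map_add' := fun y z => Subtype.ext (map_add _ _ _)
      map_smul' := fun c y => Subtype.ext (map_smul _ _ _) }
    ‖ContinuousLinearMap.adjoint (T.op t)‖ (fun y => by
      refine max_le ?_ ?_
      · exact (ContinuousLinearMap.le_opNorm (ContinuousLinearMap.adjoint (T.op t)) _).trans
          (mul_le_mul_of_nonneg_left (le_max_left _ _)
            (norm_nonneg (ContinuousLinearMap.adjoint (T.op t))))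
      · refine (le_of_eq (congrArg norm (T.adjoint_op_comm t y))).trans ?_
        exact (ContinuousLinearMap.le_opNorm (ContinuousLinearMap.adjoint (T.op t)) _).trans
          (mul_le_mul_of_nonneg_left (le_max_right _ _)
            (norm_nonneg (ContinuousLinearMap.adjoint (T.op t)))))

/-- The extension `e^{Ã t}` of the semigroup to `[D(A*)]'`, given by
`⟨e^{Ã t} z, y⟩ = ⟨z, e^{A* t} y⟩`. -/
def extend (T : C0Semigroup 𝕜 X) (t : ℝ≥0) :
    DualDomAdj T.generator →L[𝕜] DualDomAdj T.generator :=
  LinearMap.mkContinuous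
    { toFun := fun z => z.comp (T.adjointOnDom t)
      map_add' := fun _ _ => rfl
      map_smul' := fun _ _ => rfl } ‖T.adjointOnDom t‖ (fun z => by
        rw [mul_comm]
        exact z.opNorm_comp_le (T.adjointOnDom t))

/-- The operators `e^{Ã t}` do extend the operators `e^{A t}`. -/
theorem extend_pivotEmbedding (T : C0Semigroup 𝕜 X) (t : ℝ≥0) (x : X) :
    T.extend t (pivotEmbedding T.generator x) = pivotEmbedding T.generator (T.op t x) := by
  ext y
  exact ContinuousLinearMap.adjoint_inner_left (T.op t) x (DomAdj.val _ y)

/-! ### Admissibility and controllability -/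

/-- The class `L²_loc([0, ∞); U)`. -/
def _root_.IsL2Loc (f : ℝ → U) : Prop :=
  ∀ τ : ℝ, MemLp f 2 (volume.restrict (Set.Icc 0 τ))

/-- The input map `Φ(t) f = ∫₀ᵗ e^{Ã (t - s)} B f(s) ds`, an integral in `[D(A*)]'`. -/
def inputMap (T : C0Semigroup 𝕜 X) (B : U →L[𝕜] DualDomAdj T.generator) (t : ℝ) (f : ℝ → U) :
    DualDomAdj T.generator :=
  ∫ s in (0 : ℝ)..t, T.extend (t - s).toNNReal (B (f s))

/-- `Ran Φ(t)`, a subset of `[D(A*)]'`. -/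
def inputRange (T : C0Semigroup 𝕜 X) (B : U →L[𝕜] DualDomAdj T.generator) (t : ℝ) :
    Set (DualDomAdj T.generator) :=
  {z | ∃ f : ℝ → U, IsL2Loc f ∧ T.inputMap B t f = z}

/-- `B` is an admissible control operator for `T`: `Ran Φ(τ) ⊆ X` for some `τ > 0`. -/
def Admissible (T : C0Semigroup 𝕜 X) (B : U →L[𝕜] DualDomAdj T.generator) : Prop :=
  ∃ τ : ℝ, 0 < τ ∧ T.inputRange B τ ⊆ Set.range (pivotEmbedding T.generator)

/-- `(A, B)` is exactly controllable in time `τ`: `B` is admissible and `Ran Φ(τ) = X`. -/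
def ExactlyControllableIn (T : C0Semigroup 𝕜 X) (B : U →L[𝕜] DualDomAdj T.generator)
    (τ : ℝ) : Prop :=
  T.Admissible B ∧ T.inputRange B τ = Set.range (pivotEmbedding T.generator)

/-- `(A, B)` is approximately controllable in time `τ`: `B` is admissible and `Ran Φ(τ)` is dense
in `X` (for the norm of `X`). -/
def ApproxControllableIn (T : C0Semigroup 𝕜 X) (B : U →L[𝕜] DualDomAdj T.generator)
    (τ : ℝ) : Prop :=
  T.Admissible B ∧ Dense (pivotEmbedding T.generator ⁻¹' T.inputRange B τ)

/-- `(A, B)` is exactly controllable (in some time). -/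
def ExactlyControllable (T : C0Semigroup 𝕜 X) (B : U →L[𝕜] DualDomAdj T.generator) : Prop :=
  ∃ τ : ℝ, 0 < τ ∧ T.ExactlyControllableIn B τ

/-- `(A, B)` is approximately controllable (in some time). -/
def ApproxControllable (T : C0Semigroup 𝕜 X) (B : U →L[𝕜] DualDomAdj T.generator) : Prop :=
  ∃ τ : ℝ, 0 < τ ∧ T.ApproxControllableIn B τ

end C0Semigroup

/-! ### Similarity -/

/-- `A₁ ∼_P A₂`: `D(A₂) = P D(A₁)` and `P A₁ P⁻¹ = A₂`. -/
structure SimilarVia (P : X ≃L[𝕜] X) (A₁ A₂ : X →ₗ.[𝕜] X) : Prop where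
  domain_eq : (A₂.domain : Set X) = P '' (A₁.domain : Set X)
  apply_eq : ∀ (x : A₁.domain) (y : A₂.domain), (y : X) = P x → A₂ y = P (A₁ x)

/-- `P* D(A₂*) ⊆ D(A₁*)`. -/
theorem SimilarVia.adjoint_mem {P : X ≃L[𝕜] X} {A₁ A₂ : X →ₗ.[𝕜] X} (h : SimilarVia P A₁ A₂)
    (y : A₂†.domain) :
    ContinuousLinearMap.adjoint (P : X →L[𝕜] X) (y : X) ∈ A₁†.domain := by
  have hy := (LinearPMap.mem_adjoint_domain_iff (T := A₂) (y : X)).1 y.2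
  have hm : ∀ x : A₁.domain, P x ∈ A₂.domain := fun x => by
    have : P x ∈ (A₂.domain : Set X) := by
      rw [h.domain_eq]
      exact ⟨x, x.2, rfl⟩
    exact this
  rw [LinearPMap.mem_adjoint_domain_iff]
  have hc : Continuous fun x : A₁.domain => (⟨P x, hm x⟩ : A₂.domain) :=
    (P.continuous.comp continuous_subtype_val).subtype_mk _
  refine (hy.comp hc).congr fun x => ?_
  change inner 𝕜 (y : X) (A₂ ⟨P x, hm x⟩) =
    inner 𝕜 (ContinuousLinearMap.adjoint (P : X →L[𝕜] X) (y : X)) (A₁ x)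
  rw [h.apply_eq x ⟨P x, hm x⟩ rfl, ContinuousLinearMap.adjoint_inner_left]
  rfl

/-- The map `P* : D(A₂*) → D(A₁*)`. -/
def SimilarVia.adjointMap {P : X ≃L[𝕜] X} {A₁ A₂ : X →ₗ.[𝕜] X} (h : SimilarVia P A₁ A₂)
    (y : DomAdj A₂) : DomAdj A₁ :=
  (⟨ContinuousLinearMap.adjoint (P : X →L[𝕜] X) (DomAdj.val A₂ y), h.adjoint_mem y⟩ :
    A₁†.domain)

end

/-! ### Local boundedness and strong continuity -/

namespace C0Semigroup

section Basic

variable {𝕜 X : Type*} [RCLike 𝕜] [NormedAddCommGroup X] [InnerProductSpace 𝕜 X]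

/-! Every object in the definitions is natural under the isomorphism `P`. The one analytic point is
that conjugate generators have conjugate semigroups, e^{A₂t} P = P e^{A₁t} (`op_intertwine`): for x
in D(A₁) the curve s ↦ e^{A₂(t-s)} P e^{A₁s} x has zero right derivative, hence equal endpoints, and
D(A₁) is dense.

Dually, P* is bounded from D(A₂*) to D(A₁*) for the graph norms and intertwines the adjoint
semigroups. So z ↦ z ∘ P* is an isomorphism from [D(A₁*)]' onto [D(A₂*)]' (`dualEquiv`) that extends
`P`, intertwines the extended semigroups and, by hypothesis, sends B₁ to B₂. Passing it through the
integral carries Φ₁(t)f to Φ₂(t)f for the same f. The ranges therefore correspond, as do the two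
copies of X, where the isomorphism acts as the homeomorphism `P`; inclusion, equality and density
are preserved. -/

theorem op_add_apply (T : C0Semigroup 𝕜 X) (s t : ℝ≥0) (x : X) :
    T.op (s + t) x = T.op s (T.op t x) := by
  rw [T.op_add, ContinuousLinearMap.comp_apply]

/-- A `C₀`-semigroup is bounded near time zero. -/
theorem exists_bound_near_zero [CompleteSpace X] (T : C0Semigroup 𝕜 X) :
    ∃ M : ℝ, ∀ᶠ t in 𝓝 (0 : ℝ≥0), ‖T.op t‖ ≤ M := by
  by_contra! hcon
  have hex : ∀ n : ℕ, ∃ t : ℝ≥0, (n : ℝ) < ‖T.op t‖ ∧ t < 1 / ((n : ℝ≥0) + 1) := fun n => by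
    have h := hcon n
    obtain ⟨t, ht, ht'⟩ := (h.and_eventually (Iio_mem_nhds
      (show (0 : ℝ≥0) < 1 / ((n : ℝ≥0) + 1) by positivity))).exists
    exact ⟨t, ht, ht'⟩
  choose u hu hu' using hex
  have hlim : Tendsto u atTop (𝓝 0) :=
    tendsto_of_tendsto_of_tendsto_of_le_of_le tendsto_const_nhds
      tendsto_one_div_add_atTop_nhds_zero_nat (fun _ => zero_le) fun n => (hu' n).le
  -- Each orbit converges along u n → 0, hence is bounded there; uniform boundedness then
  -- contradicts ‖T(u n)‖ > n.
  obtain ⟨C, hC⟩ := banach_steinhaus (g := fun n => T.op (u n)) fun x => by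
    obtain ⟨C, hC⟩ := ((T.tendsto_zero x).comp hlim).norm.bddAbove_range
    exact ⟨C, fun n => hC ⟨n, rfl⟩⟩
  obtain ⟨n, hn⟩ := exists_nat_gt C
  exact absurd (hC n) (not_le.2 (hn.trans (hu n)))

/-- A `C₀`-semigroup is bounded on bounded time intervals. -/
theorem exists_bound [CompleteSpace X] (T : C0Semigroup 𝕜 X) (τ : ℝ≥0) :
    ∃ M : ℝ, 0 ≤ M ∧ ∀ t ≤ τ, ‖T.op t‖ ≤ M := by
  obtain ⟨M, hM⟩ := T.exists_bound_near_zero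
  obtain ⟨δ, hδ, hball⟩ := Metric.eventually_nhds_iff.1 hM
  lift δ to ℝ≥0 using hδ.le
  have hδ' : 0 < δ := by exact_mod_cast hδ
  have hsmall : ∀ t ≤ δ / 2, ‖T.op t‖ ≤ max M 1 := fun t ht => by
    refine (hball ?_).trans (le_max_left _ _)
    rw [NNReal.dist_eq, NNReal.coe_zero, sub_zero, abs_of_nonneg t.coe_nonneg]
    exact_mod_cast ht.trans_lt (NNReal.half_lt_self hδ'.ne')
  -- Times are split into steps of length δ/2, which stay inside the open ball of radius δ. The
  -- maximum with 1 makes the powers increase with the number of factors.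
  have hpow : ∀ n : ℕ, ∀ t ≤ n * (δ / 2), ‖T.op t‖ ≤ max M 1 ^ (n + 1) := fun n => by
    induction n with
    | zero =>
      intro t ht
      simpa using hsmall t (ht.trans (by simp))
    | succ n ih =>
      intro t ht
      have h1 : (1 : ℝ) ≤ max M 1 := le_max_right _ _
      rcases le_total t (δ / 2) with h | h
      · exact (hsmall t h).trans (le_self_pow₀ h1 (by simp))
      · obtain ⟨c, rfl⟩ := exists_add_of_le h
        have hc : c ≤ n * (δ / 2) := by
          rw [Nat.cast_succ, add_mul, one_mul, add_comm] at ht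
          exact le_of_add_le_add_right ht
        rw [T.op_add, pow_succ' _ (n + 1)]
        exact (ContinuousLinearMap.opNorm_comp_le _ _).trans
          (mul_le_mul (hsmall _ le_rfl) (ih c hc) (norm_nonneg _) (zero_le_one.trans h1))
  obtain ⟨n, hn⟩ := exists_nat_gt (τ / (δ / 2))
  refine ⟨_, by positivity, fun t ht => hpow n t (ht.trans ?_)⟩
  exact ((div_lt_iff₀ (half_pos hδ')).1 hn).le

/-- The orbits of a `C₀`-semigroup are continuous. -/
theorem continuous_orbit [CompleteSpace X] (T : C0Semigroup 𝕜 X) (x : X) :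
    Continuous fun t => T.op t x := by
  refine continuous_iff_continuousAt.2 fun t₀ => ?_
  obtain ⟨M, hM0, hM⟩ := T.exists_bound (t₀ + 1)
  have hd : Tendsto (fun t : ℝ≥0 => nndist t t₀) (𝓝 t₀) (𝓝 0) := by
    have h : Continuous fun t : ℝ≥0 => nndist t t₀ := by fun_prop
    simpa using h.tendsto t₀
  have hlim : Tendsto (fun t : ℝ≥0 => M * ‖T.op (nndist t t₀) x - x‖) (𝓝 t₀) (𝓝 0) := by
    simpa using ((((T.tendsto_zero x).comp hd).sub_const x).norm).const_mul M
  refine tendsto_iff_norm_sub_tendsto_zero.2 (squeeze_zero' (Eventually.of_forall fun _ =>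
    norm_nonneg _) ?_ hlim)
  filter_upwards [Iio_mem_nhds (show t₀ < t₀ + 1 from lt_add_of_pos_right _ one_pos)] with t ht
  -- Taking a to be the smaller of t and t₀ treats left and right continuity alike, with no need to
  -- invert T.
  have key : ∀ a c : ℝ≥0, a ≤ t₀ + 1 →
      ‖T.op (a + c) x - T.op a x‖ ≤ M * ‖T.op c x - x‖ := fun a c ha => by
    rw [op_add_apply, ← map_sub]
    exact (T.op a).le_of_opNorm_le (hM a ha) _
  have hnn : ∀ a c : ℝ≥0, nndist (a + c) a = c := fun a c => by
    rw [← NNReal.coe_inj, coe_nndist, NNReal.dist_eq]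
    simp
  rcases le_total t₀ t with h | h
  · obtain ⟨c, rfl⟩ := exists_add_of_le h
    rw [hnn]
    exact key _ _ (le_add_of_nonneg_right zero_le)
  · obtain ⟨c, rfl⟩ := exists_add_of_le h
    rw [nndist_comm, hnn, norm_sub_rev]
    exact key _ _ (le_of_lt ht)

/-- A `C₀`-semigroup acts jointly continuously. -/
theorem continuous_op_apply [CompleteSpace X] (T : C0Semigroup 𝕜 X) :
    Continuous fun p : ℝ≥0 × X => T.op p.1 p.2 := by
  refine continuous_iff_continuousAt.2 fun ⟨t₀, x₀⟩ => ?_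
  obtain ⟨M, hM0, hM⟩ := T.exists_bound (t₀ + 1)
  have hlim : Tendsto (fun p : ℝ≥0 × X => M * ‖p.2 - x₀‖ + ‖T.op p.1 x₀ - T.op t₀ x₀‖)
      (𝓝 (t₀, x₀)) (𝓝 0) := by
    have h : Continuous fun p : ℝ≥0 × X =>
        M * ‖p.2 - x₀‖ + ‖T.op p.1 x₀ - T.op t₀ x₀‖ := by
      have := (T.continuous_orbit x₀).comp (continuous_fst (X := ℝ≥0) (Y := X))
      exact ((continuous_snd.sub continuous_const).norm.const_mul M).add
        (this.sub continuous_const).norm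
    simpa using h.tendsto (t₀, x₀)
  refine tendsto_iff_norm_sub_tendsto_zero.2 (squeeze_zero' (Eventually.of_forall fun _ =>
    norm_nonneg _) ?_ hlim)
  filter_upwards [(continuous_fst.tendsto (t₀, x₀)).eventually
    (Iio_mem_nhds (show t₀ < t₀ + 1 from lt_add_of_pos_right _ one_pos))] with p hp
  calc ‖T.op p.1 p.2 - T.op t₀ x₀‖
      = ‖T.op p.1 (p.2 - x₀) + (T.op p.1 x₀ - T.op t₀ x₀)‖ := by
        rw [map_sub, sub_add_sub_cancel]
    _ ≤ _ := (norm_add_le _ _).trans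
        (add_le_add_left ((T.op p.1).le_of_opNorm_le (hM _ (le_of_lt hp)) _) _)

/-- Right limits at real times are thereby reduced to the limits over `ℝ≥0` that define the
generator. -/
theorem tendsto_toNNReal_sub_nhdsGT (s : ℝ) :
    Tendsto (fun u : ℝ => (u - s).toNNReal) (𝓝[>] s) (𝓝[>] 0) := by
  refine tendsto_nhdsWithin_iff.2 ⟨?_, ?_⟩
  · have h : Continuous fun u : ℝ => (u - s).toNNReal := by fun_prop
    simpa using (h.tendsto s).mono_left nhdsWithin_le_nhds
  · filter_upwards [self_mem_nhdsWithin] with u hu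
    exact Real.toNNReal_pos.2 (sub_pos.2 hu)

theorem tendsto_coe_nhdsGT_zero : Tendsto (fun h : ℝ≥0 => (h : ℝ)) (𝓝[>] 0) (𝓝[>] 0) := by
  refine tendsto_nhdsWithin_iff.2 ⟨?_, ?_⟩
  · exact (NNReal.continuous_coe.tendsto 0).mono_left nhdsWithin_le_nhds
  · filter_upwards [self_mem_nhdsWithin] with u hu
    exact NNReal.coe_pos.2 hu

/-! ### Density of the domain of the generator -/

section Real

variable [CompleteSpace X] [NormedSpace ℝ X] [IsScalarTower ℝ 𝕜 X]

/-- Integrals of orbits lie in the domain of the generator. -/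
theorem hasGen_integral (T : C0Semigroup 𝕜 X) (x : X) (t : ℝ≥0) :
    T.HasGen (∫ s in (0 : ℝ)..t, T.op s.toNNReal x) (T.op t x - x) := by
  set g : ℝ → X := fun s => T.op s.toNNReal x with hg
  have hgc : Continuous g := (T.continuous_orbit x).comp continuous_real_toNNReal
  have hint : ∀ a b : ℝ, IntervalIntegrable g volume a b := fun a b => hgc.intervalIntegrable a b
  have hderiv : ∀ b : ℝ, HasDerivAt (fun u => ∫ s in (0 : ℝ)..u, g s) (g b) b :=
    fun b => (hgc.integral_hasStrictDerivAt 0 b).hasDerivAt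
  -- T(r) shifts the integral, and ∫ over [r, r+t] minus ∫ over [0, t] equals ∫ over [t, t+r] minus
  -- ∫ over [0, r]. Divided by r, these are difference quotients of the primitive at t and at 0.
  have h1 := ((hderiv t).tendsto_slope_zero_right.comp tendsto_coe_nhdsGT_zero).sub
    ((hderiv 0).tendsto_slope_zero_right.comp tendsto_coe_nhdsGT_zero)
  have h0 : g t - g 0 = T.op t x - x := by simp [hg, T.op_zero]
  rw [h0] at h1
  refine h1.congr fun r => ?_
  have hshift : T.op r (∫ s in (0 : ℝ)..t, g s) = ∫ s in (r : ℝ)..(r + t), g s := by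
    rw [← (T.op r).intervalIntegral_comp_comm (hint _ _)]
    have h2 : ∫ s in (0 : ℝ)..t, T.op r (g s) = ∫ s in (0 : ℝ)..t, g (r + s) := by
      refine intervalIntegral.integral_congr fun s hs => ?_
      rw [Set.uIcc_of_le t.coe_nonneg] at hs
      simp only [hg]
      rw [Real.toNNReal_add r.coe_nonneg hs.1, Real.toNNReal_coe, op_add_apply]
    rw [h2, intervalIntegral.integral_comp_add_left, add_zero]
  rw [hshift, ← RCLike.real_smul_eq_coe_smul]
  simp only [Function.comp_apply, zero_add, intervalIntegral.integral_same, sub_zero]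
  rw [← smul_sub, add_comm (t : ℝ) r,
    ← intervalIntegral.integral_add_adjacent_intervals (hint 0 r) (hint r (r + t))]
  congr 1
  abel

theorem dense_genDomain_of_real (T : C0Semigroup 𝕜 X) :
    Dense (T.generator.domain : Set X) := by
  intro x
  set g : ℝ → X := fun s => T.op s.toNNReal x with hg
  have hgc : Continuous g := (T.continuous_orbit x).comp continuous_real_toNNReal
  -- x is the limit of the averages h⁻¹ ∫₀ʰ T(s)x ds, which lie in the domain.
  have hd := ((hgc.integral_hasStrictDerivAt 0 0).hasDerivAt).tendsto_slope_zero_right.comp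
    tendsto_coe_nhdsGT_zero
  have h0 : g 0 = x := by simp [hg, T.op_zero]
  rw [h0] at hd
  refine mem_closure_of_tendsto hd (Eventually.of_forall fun t => ?_)
  simp only [Function.comp_apply, zero_add, intervalIntegral.integral_same, sub_zero]
  rw [RCLike.real_smul_eq_coe_smul (K := 𝕜)]
  exact Submodule.smul_mem _ _ ⟨_, T.hasGen_integral x t⟩

/-! ### Intertwining of semigroups through their generators -/

/-- A bounded operator intertwining the generators of two semigroups intertwines the semigroups
on the domain of the generator. -/
theorem op_intertwine_of_real (S T : C0Semigroup 𝕜 X) (W : X →L[𝕜] X)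
    (hW : ∀ x y, S.HasGen x y → T.HasGen (W x) (W y)) {x y : X} (hx : S.HasGen x y) (t : ℝ≥0) :
    T.op t (W x) = W (S.op t x) := by
  obtain ⟨M, hM0, hM⟩ := T.exists_bound t
  -- F interpolates between T(t)Wx at s = 0 and WS(t)x at s = t. Since the generator is a right
  -- limit, only right derivatives are available; with continuity they suffice for constancy.
  set F : ℝ → X := fun s => T.op (t - s.toNNReal) (W (S.op s.toNNReal x)) with hF
  have hFc : Continuous F :=
    T.continuous_op_apply.comp ((continuous_const.sub continuous_real_toNNReal).prodMk
      (W.continuous.comp ((S.continuous_orbit x).comp continuous_real_toNNReal)))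
  have hFd : ∀ s ∈ Set.Ico (0 : ℝ) t, HasDerivWithinAt F 0 (Set.Ici s) s := by
    rintro s ⟨hs0, hst⟩
    rw [← hasDerivWithinAt_Ioi_iff_Ici, hasDerivWithinAt_iff_tendsto_slope' (by simp)]
    lift s to ℝ≥0 using hs0
    have hst' : s < t := by exact_mod_cast hst
    have hS := hx.op s
    have hlim : Tendsto (fun h : ℝ≥0 => M * ‖W ((((h : ℝ)⁻¹ : ℝ) : 𝕜) •
        (S.op h (S.op s x) - S.op s x)) - (((h : ℝ)⁻¹ : ℝ) : 𝕜) •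
        (T.op h (W (S.op s x)) - W (S.op s x))‖) (𝓝[>] 0) (𝓝 0) := by
      simpa using ((((W.continuous.tendsto _).comp hS).sub (hW _ _ hS)).norm).const_mul M
    refine squeeze_zero_norm' ?_ (hlim.comp (tendsto_toNNReal_sub_nhdsGT (s : ℝ)))
    filter_upwards [Ioo_mem_nhdsGT hst] with u hu
    have hsu : 0 ≤ u - s := sub_nonneg.2 hu.1.le
    obtain ⟨h, hh⟩ : ∃ h : ℝ≥0, u - s = h := ⟨⟨u - s, hsu⟩, rfl⟩
    have hu' : u = ((s + h : ℝ≥0) : ℝ) := by push_cast; linarith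
    have hle : s + h ≤ t := by
      have := hu.2.le
      rw [hu'] at this
      exact_mod_cast this
    have hts : t - s = (t - (s + h)) + h := by
      refine tsub_eq_of_eq_add_rev ?_
      rw [add_comm _ h, ← add_assoc]
      exact (add_tsub_cancel_of_le hle).symm
    -- Inside T(t-s-h) stands the difference of two quotients, both tending to WS(s)y; M bounds the
    -- outer factor uniformly in h.
    have hslope : slope F s u = T.op (t - (s + h)) (W ((((h : ℝ)⁻¹ : ℝ) : 𝕜) •
        (S.op h (S.op s x) - S.op s x)) - (((h : ℝ)⁻¹ : ℝ) : 𝕜) •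
        (T.op h (W (S.op s x)) - W (S.op s x))) := by
      rw [slope_def_module, hh, hu', RCLike.real_smul_eq_coe_smul (K := 𝕜)]
      simp only [hF, Real.toNNReal_coe]
      rw [add_comm s h, op_add_apply, add_comm h s, hts, op_add_apply, map_smul, ← smul_sub,
        map_smul, ← map_sub, map_sub W]
      congr 2
      abel
    rw [hslope, Function.comp_apply, hh, Real.toNNReal_coe]
    exact (T.op _).le_of_opNorm_le (hM _ tsub_le_self) _
  have := constant_of_has_deriv_right_zero hFc.continuousOn hFd t ⟨t.2, le_rfl⟩
  simp only [hF, Real.toNNReal_coe, tsub_self, Real.toNNReal_zero, tsub_zero, T.op_zero,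
    S.op_zero, ContinuousLinearMap.id_apply] at this
  exact this.symm

end Real

/-- The generator of a `C₀`-semigroup is densely defined. -/
theorem dense_generator_domain [CompleteSpace X] (T : C0Semigroup 𝕜 X) :
    Dense (T.generator.domain : Set X) := by
  -- The real structure needed for calculus is chosen inside the proof, so the statement does not
  -- depend on it.
  let _ : NormedSpace ℝ X := NormedSpace.restrictScalars ℝ 𝕜 X
  have : IsScalarTower ℝ 𝕜 X := .of_algebraMap_smul fun _ _ => rfl
  exact T.dense_genDomain_of_real

/-- A bounded operator intertwining the generators of two semigroups intertwines the
semigroups. -/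
theorem op_intertwine [CompleteSpace X] (S T : C0Semigroup 𝕜 X) (W : X →L[𝕜] X)
    (hW : ∀ x y, S.HasGen x y → T.HasGen (W x) (W y)) (t : ℝ≥0) (x : X) :
    T.op t (W x) = W (S.op t x) := by
  let _ : NormedSpace ℝ X := NormedSpace.restrictScalars ℝ 𝕜 X
  have : IsScalarTower ℝ 𝕜 X := .of_algebraMap_smul fun _ _ => rfl
  refine congrFun (Continuous.ext_on S.dense_generator_domain
    ((T.op t).continuous.comp W.continuous) (W.continuous.comp (S.op t).continuous) ?_) x
  rintro z ⟨y, hy⟩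
  exact op_intertwine_of_real S T W hW hy t

end Basic

end C0Semigroup

/-! ### The isomorphism of `[D(A₁*)]'` and `[D(A₂*)]'` induced by a similarity -/

namespace SimilarVia

section

variable {𝕜 X : Type*} [RCLike 𝕜] [NormedAddCommGroup X] [InnerProductSpace 𝕜 X]
variable {P : X ≃L[𝕜] X} {A₁ A₂ : X →ₗ.[𝕜] X}

theorem symm (h : SimilarVia P A₁ A₂) : SimilarVia P.symm A₂ A₁ where
  domain_eq := by
    rw [h.domain_eq, Set.image_image]
    simp
  apply_eq x y hxy := by
    rw [h.apply_eq y x (by rw [hxy, P.apply_symm_apply]), P.symm_apply_apply]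

theorem map_mem (h : SimilarVia P A₁ A₂) (x : A₁.domain) : P x ∈ A₂.domain := by
  have : P x ∈ (A₂.domain : Set X) := by
    rw [h.domain_eq]
    exact ⟨x, x.2, rfl⟩
  exact this

theorem hasGen_map {T₁ T₂ : C0Semigroup 𝕜 X}
    (h : SimilarVia P T₁.generator T₂.generator) {x y : X}
    (hxy : T₁.HasGen x y) : T₂.HasGen (P x) (P y) := by
  have hx : x ∈ T₁.generator.domain := ⟨y, hxy⟩
  have hs := T₂.generator_spec ⟨P x, h.map_mem ⟨x, hx⟩⟩
  rwa [h.apply_eq ⟨x, hx⟩ ⟨P x, h.map_mem ⟨x, hx⟩⟩ rfl,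
    (T₁.generator_spec ⟨x, hx⟩).unique hxy] at hs

variable [CompleteSpace X]

theorem val_adjointMap (h : SimilarVia P A₁ A₂) (y : DomAdj A₂) :
    DomAdj.val A₁ (h.adjointMap y) =
      ContinuousLinearMap.adjoint (P : X →L[𝕜] X) (DomAdj.val A₂ y) :=
  rfl

/-- `A₁* P* = P* A₂*` on `D(A₂*)`. -/
theorem adj_adjointMap (h : SimilarVia P A₁ A₂) (h₁ : Dense (A₁.domain : Set X))
    (h₂ : Dense (A₂.domain : Set X)) (y : DomAdj A₂) :
    DomAdj.adj A₁ (h.adjointMap y) =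
      ContinuousLinearMap.adjoint (P : X →L[𝕜] X) (DomAdj.adj A₂ y) := by
  -- As D(A₁) is dense, the value of A₁* is determined by its pairings with D(A₁).
  refine LinearPMap.adjoint_apply_eq h₁ (h.adjointMap y : A₁†.domain) fun x => ?_
  have hf := LinearPMap.adjoint_isFormalAdjoint (T := A₂) h₂ y ⟨P x, h.map_mem x⟩
  rw [h.apply_eq x ⟨P x, h.map_mem x⟩ rfl] at hf
  change inner 𝕜 _ _ =
    inner 𝕜 (ContinuousLinearMap.adjoint (P : X →L[𝕜] X) (DomAdj.val A₂ y)) (A₁ x)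
  rw [ContinuousLinearMap.adjoint_inner_left, ContinuousLinearMap.adjoint_inner_left]
  exact hf

/-- The map `P* : D(A₂*) → D(A₁*)` as a bounded operator for the graph norms. -/
noncomputable def adjointCLM (h : SimilarVia P A₁ A₂) (h₁ : Dense (A₁.domain : Set X))
    (h₂ : Dense (A₂.domain : Set X)) : DomAdj A₂ →L[𝕜] DomAdj A₁ :=
  LinearMap.mkContinuous
    { toFun := h.adjointMap
      map_add' := fun y z => DomAdj.val_injective A₁ (by simp only [map_add, val_adjointMap])
      map_smul' := fun c y => DomAdj.val_injective A₁ (by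
        simp only [map_smul, val_adjointMap, RingHom.id_apply]) }
    ‖ContinuousLinearMap.adjoint (P : X →L[𝕜] X)‖ (fun y => by
      refine max_le ?_ ?_
      · exact (ContinuousLinearMap.le_opNorm (ContinuousLinearMap.adjoint (P : X →L[𝕜] X)) _).trans
          (mul_le_mul_of_nonneg_left (le_max_left _ _) (norm_nonneg _))
      · refine (le_of_eq (congrArg norm (h.adj_adjointMap h₁ h₂ y))).trans ?_
        exact (ContinuousLinearMap.le_opNorm (ContinuousLinearMap.adjoint (P : X →L[𝕜] X)) _).trans
          (mul_le_mul_of_nonneg_left (le_max_right _ _) (norm_nonneg _)))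

/-- Adjoints reverse products: (P⁻¹)* P* = (P P⁻¹)* = 1. Used for both `h` and `h.symm`, this makes
P* a bijection of D(A₂*) onto D(A₁*). -/
theorem adjointMap_symm_adjointMap (h : SimilarVia P A₁ A₂) (y : DomAdj A₂) :
    h.symm.adjointMap (h.adjointMap y) = y := by
  refine DomAdj.val_injective A₂ (ext_inner_right 𝕜 fun x => ?_)
  rw [val_adjointMap, val_adjointMap, ContinuousLinearMap.adjoint_inner_left,
    ContinuousLinearMap.adjoint_inner_left]
  exact congrArg _ (P.apply_symm_apply x)

/-- The extension of `P` to a bounded operator `[D(A₁*)]' → [D(A₂*)]'`, `z ↦ z ∘ P*`. -/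
noncomputable def dualCLM (h : SimilarVia P A₁ A₂) (h₁ : Dense (A₁.domain : Set X))
    (h₂ : Dense (A₂.domain : Set X)) : DualDomAdj A₁ →L[𝕜] DualDomAdj A₂ :=
  LinearMap.mkContinuous
    { toFun := fun z => z.comp (h.adjointCLM h₁ h₂)
      map_add' := fun _ _ => rfl
      map_smul' := fun _ _ => rfl } ‖h.adjointCLM h₁ h₂‖ (fun z => by
        rw [mul_comm]
        exact z.opNorm_comp_le (h.adjointCLM h₁ h₂))

theorem dualCLM_apply (h : SimilarVia P A₁ A₂) (h₁ : Dense (A₁.domain : Set X))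
    (h₂ : Dense (A₂.domain : Set X)) (z : DualDomAdj A₁) (y : DomAdj A₂) :
    h.dualCLM h₁ h₂ z y = z (h.adjointMap y) :=
  rfl

/-- The extension of `P` to an isomorphism `[D(A₁*)]' ≃ [D(A₂*)]'`. -/
noncomputable def dualEquiv (h : SimilarVia P A₁ A₂) (h₁ : Dense (A₁.domain : Set X))
    (h₂ : Dense (A₂.domain : Set X)) : DualDomAdj A₁ ≃L[𝕜] DualDomAdj A₂ :=
  ContinuousLinearEquiv.equivOfInverse (h.dualCLM h₁ h₂) (h.symm.dualCLM h₂ h₁)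
    (fun z => by
      ext y
      rw [dualCLM_apply, dualCLM_apply]
      exact congrArg z (h.symm.adjointMap_symm_adjointMap y))
    (fun z => by
      ext y
      rw [dualCLM_apply, dualCLM_apply, adjointMap_symm_adjointMap])

theorem dualEquiv_apply (h : SimilarVia P A₁ A₂) (h₁ : Dense (A₁.domain : Set X))
    (h₂ : Dense (A₂.domain : Set X)) (z : DualDomAdj A₁) (y : DomAdj A₂) :
    h.dualEquiv h₁ h₂ z y = z (h.adjointMap y) :=
  rfl

theorem dualEquiv_pivotEmbedding (h : SimilarVia P A₁ A₂) (h₁ : Dense (A₁.domain : Set X))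
    (h₂ : Dense (A₂.domain : Set X)) (x : X) :
    h.dualEquiv h₁ h₂ (pivotEmbedding A₁ x) = pivotEmbedding A₂ (P x) := by
  ext y
  exact ContinuousLinearMap.adjoint_inner_left (P : X →L[𝕜] X) x (DomAdj.val A₂ y)

theorem range_pivotEmbedding (h : SimilarVia P A₁ A₂) (h₁ : Dense (A₁.domain : Set X))
    (h₂ : Dense (A₂.domain : Set X)) :
    Set.range (pivotEmbedding A₂) = h.dualEquiv h₁ h₂ '' Set.range (pivotEmbedding A₁) := by
  rw [← Set.range_comp, ← P.surjective.range_comp]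
  exact congrArg Set.range (funext fun x => (h.dualEquiv_pivotEmbedding h₁ h₂ x).symm)

/-! ### Transport of semigroups and input maps along a similarity -/

variable {T₁ T₂ : C0Semigroup 𝕜 X}

/-- `e^{A₂ t} P = P e^{A₁ t}`. -/
theorem op_map (h : SimilarVia P T₁.generator T₂.generator) (t : ℝ≥0) (x : X) :
    T₂.op t (P x) = P (T₁.op t x) :=
  C0Semigroup.op_intertwine T₁ T₂ (P : X →L[𝕜] X) (fun _ _ => h.hasGen_map) t x

/-- This is the adjoint of the relation `op_map`. -/
theorem adjointMap_adjointOnDom (h : SimilarVia P T₁.generator T₂.generator) (t : ℝ≥0)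
    (y : DomAdj T₂.generator) :
    h.adjointMap (T₂.adjointOnDom t y) = T₁.adjointOnDom t (h.adjointMap y) := by
  refine DomAdj.val_injective _ (ext_inner_right 𝕜 fun x => ?_)
  change inner 𝕜 (ContinuousLinearMap.adjoint (P : X →L[𝕜] X)
      (ContinuousLinearMap.adjoint (T₂.op t) (DomAdj.val _ y))) x =
    inner 𝕜 (ContinuousLinearMap.adjoint (T₁.op t)
      (ContinuousLinearMap.adjoint (P : X →L[𝕜] X) (DomAdj.val _ y))) x
  simp only [ContinuousLinearMap.adjoint_inner_left]
  exact congrArg _ (h.op_map t x)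

theorem dualEquiv_extend (h : SimilarVia P T₁.generator T₂.generator)
    (h₁ : Dense (T₁.generator.domain : Set X)) (h₂ : Dense (T₂.generator.domain : Set X))
    (t : ℝ≥0) (z : DualDomAdj T₁.generator) :
    h.dualEquiv h₁ h₂ (T₁.extend t z) = T₂.extend t (h.dualEquiv h₁ h₂ z) := by
  ext y
  exact congrArg z (h.adjointMap_adjointOnDom t y).symm

variable {U : Type*} [NormedAddCommGroup U] [InnerProductSpace 𝕜 U]
variable {B₁ : U →L[𝕜] DualDomAdj T₁.generator} {B₂ : U →L[𝕜] DualDomAdj T₂.generator}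

theorem dualEquiv_inputMap (h : SimilarVia P T₁.generator T₂.generator)
    (h₁ : Dense (T₁.generator.domain : Set X)) (h₂ : Dense (T₂.generator.domain : Set X))
    (hB : ∀ u x, B₂ u x = B₁ u (h.adjointMap x)) (t : ℝ) (f : ℝ → U) :
    h.dualEquiv h₁ h₂ (T₁.inputMap B₁ t f) = T₂.inputMap B₂ t f := by
  have hBu : ∀ u, h.dualEquiv h₁ h₂ (B₁ u) = B₂ u := fun u => by
    ext x
    rw [dualEquiv_apply, hB]
  -- A continuous linear isomorphism commutes with the Bochner integral even when the integrand is
  -- not integrable, so no integrability has to be checked.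
  simp only [C0Semigroup.inputMap, intervalIntegral, map_sub,
    ← ContinuousLinearEquiv.integral_comp_comm, dualEquiv_extend, hBu]

theorem inputRange_eq (h : SimilarVia P T₁.generator T₂.generator)
    (h₁ : Dense (T₁.generator.domain : Set X)) (h₂ : Dense (T₂.generator.domain : Set X))
    (hB : ∀ u x, B₂ u x = B₁ u (h.adjointMap x)) (t : ℝ) :
    T₂.inputRange B₂ t = h.dualEquiv h₁ h₂ '' T₁.inputRange B₁ t := by
  ext z
  constructor
  · rintro ⟨f, hf, rfl⟩
    exact ⟨_, ⟨f, hf, rfl⟩, h.dualEquiv_inputMap h₁ h₂ hB t f⟩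
  · rintro ⟨_, ⟨f, hf, rfl⟩, rfl⟩
    exact ⟨f, hf, (h.dualEquiv_inputMap h₁ h₂ hB t f).symm⟩

/-! ### Invariance of admissibility and controllability. -/

theorem admissible_iff (h : SimilarVia P T₁.generator T₂.generator)
    (hB : ∀ u x, B₂ u x = B₁ u (h.adjointMap x)) : T₁.Admissible B₁ ↔ T₂.Admissible B₂ := by
  have h₁ := T₁.dense_generator_domain
  have h₂ := T₂.dense_generator_domain
  simp only [C0Semigroup.Admissible, h.inputRange_eq h₁ h₂ hB, h.range_pivotEmbedding h₁ h₂,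
    Set.image_subset_image_iff (h.dualEquiv h₁ h₂).injective]

theorem exactlyControllableIn_iff (h : SimilarVia P T₁.generator T₂.generator)
    (hB : ∀ u x, B₂ u x = B₁ u (h.adjointMap x)) (τ : ℝ) :
    T₁.ExactlyControllableIn B₁ τ ↔ T₂.ExactlyControllableIn B₂ τ := by
  have h₁ := T₁.dense_generator_domain
  have h₂ := T₂.dense_generator_domain
  rw [C0Semigroup.ExactlyControllableIn, C0Semigroup.ExactlyControllableIn, h.admissible_iff hB,
    h.inputRange_eq h₁ h₂ hB, h.range_pivotEmbedding h₁ h₂,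
    (h.dualEquiv h₁ h₂).injective.image_injective.eq_iff]

theorem approxControllableIn_iff (h : SimilarVia P T₁.generator T₂.generator)
    (hB : ∀ u x, B₂ u x = B₁ u (h.adjointMap x)) (τ : ℝ) :
    T₁.ApproxControllableIn B₁ τ ↔ T₂.ApproxControllableIn B₂ τ := by
  have h₁ := T₁.dense_generator_domain
  have h₂ := T₂.dense_generator_domain
  -- Density is meant in the norm of X, so the correspondence of ranges is first pulled back to X,
  -- where it is given by `P`.
  have hpre : pivotEmbedding T₁.generator ⁻¹' T₁.inputRange B₁ τ =
      P ⁻¹' (pivotEmbedding T₂.generator ⁻¹' T₂.inputRange B₂ τ) := by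
    ext x
    rw [Set.mem_preimage, Set.mem_preimage, Set.mem_preimage, h.inputRange_eq h₁ h₂ hB,
      ← h.dualEquiv_pivotEmbedding h₁ h₂, (h.dualEquiv h₁ h₂).injective.mem_set_image]
  rw [C0Semigroup.ApproxControllableIn, C0Semigroup.ApproxControllableIn, h.admissible_iff hB,
    hpre]
  refine and_congr_right fun _ => ⟨fun hd => ?_, fun hd => hd.preimage P.toHomeomorph.isOpenMap⟩
  have hd' := hd.preimage P.symm.toHomeomorph.isOpenMap
  rw [← Set.preimage_comp] at hd'
  convert hd' using 1
  ext x
  simp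

end

end SimilarVia

theorem mainTheorem6 {𝕜 X U : Type*} [RCLike 𝕜]
    [NormedAddCommGroup X] [InnerProductSpace 𝕜 X] [CompleteSpace X]
    [NormedAddCommGroup U] [InnerProductSpace 𝕜 U] [CompleteSpace U]
    (T₁ T₂ : C0Semigroup 𝕜 X)
    (B₁ : U →L[𝕜] DualDomAdj T₁.generator) (B₂ : U →L[𝕜] DualDomAdj T₂.generator)
    (P : X ≃L[𝕜] X) (hP : SimilarVia P T₁.generator T₂.generator)
    (hB : ∀ (u : U) (x : DomAdj T₂.generator), B₂ u x = B₁ u (hP.adjointMap x)) :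
    (T₁.Admissible B₁ ↔ T₂.Admissible B₂) ∧
    (∀ τ : ℝ, 0 < τ → (T₁.ExactlyControllableIn B₁ τ ↔ T₂.ExactlyControllableIn B₂ τ)) ∧
    (∀ τ : ℝ, 0 < τ → (T₁.ApproxControllableIn B₁ τ ↔ T₂.ApproxControllableIn B₂ τ)) ∧
    (T₁.ExactlyControllable B₁ ↔ T₂.ExactlyControllable B₂) ∧
    (T₁.ApproxControllable B₁ ↔ T₂.ApproxControllable B₂) := by
  exact ⟨hP.admissible_iff hB, fun τ _ => hP.exactlyControllableIn_iff hB τ,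
    fun τ _ => hP.approxControllableIn_iff hB τ,
    exists_congr fun τ => and_congr_right fun _ => hP.exactlyControllableIn_iff hB τ,
    exists_congr fun τ => and_congr_right fun _ => hP.approxControllableIn_iff hB τ⟩
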